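/- Let $n,d\ge 1$ and equip $\mathbb R^n$ with the Euclidean inner product. Equip $\bigotimes^d\mathbb R^n$ with the Hilbert–Schmidt inner product determined by $\langle y_1\otimes\cdots\otimes y_d,\,x_1\otimes\cdots\otimes x_d\rangle=\prod_{i=1}^d\langle y_i,x_i\rangle$, and let $\mathrm{HS}(\mathbf u)=\sqrt{\langle\mathbf u,\mathbf u\rangle}$. For $\mathbf z\in\bigotimes^d\mathbb R^n$ let $\operatorname{L}_{\mathbf z}$ be the $d$-linear form $\operatorname{L}_{\mathbf z}(y_1,\dots,y_d)=\langle \mathbf z,\,y_1\otimes\cdots\otimes y_d\rangle$; that is, $\operatorname{L}_{\mathbf z}(y_1,\dots,y_d)=\sum_j\prod_i\langle y_i,z_i^j\rangle$ if $\mathbf z=\sum_j z_1^j\otimes\cdots\otimes z_d^j$. The norm of a $d$-linear form $\operatorname{L}$ on a Euclidean space is $\|\operatorname{L}\|=\sup\{|\operatorname{L}(y_1,\dots,y_d)|:\|y_1\|=\cdots=\|y_d\|=1\}$. Let $\mathbf z\in\bigotimes^d\mathbb R^n$ be a symmetric tensor and let $\mathbf x=\lambda\,x_1\otimes\cdots\otimes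 x_d$, with $\lambda\in\mathbb R$ and $x_1,\dots,x_d\in\mathbb R^n$ unit vectors, be a best rank-$1$ approximation of $\mathbf z$ for the Hilbert–Schmidt norm, i.e. $\mathrm{HS}(\mathbf z-\mathbf x)\le \mathrm{HS}(\mathbf z-\mathbf y)$ for every tensor $\mathbf y$ of tensor rank at most $1$. Put $\mathcal H=\operatorname{span}\{x_1,\dots,x_d\}$. 1. If $\mathbf z\neq 0$, then $\dim\mathcal H\le 2$. 2. If $\dim\mathcal H=2$, then the restriction of $\operatorname{L}_{\mathbf z}$ to $\mathcal H$ is the one and only symmetric $d$-linear form $T$ on $\mathcal H$ such that $\|T\|=|\lambda|$ and $T(x_1,\dots,x_d)=\lambda$. (In particular the restriction of $\operatorname{L}_{\mathbf z}$ itself has these properties.) -/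

import Mathlib

open scoped TensorProduct

noncomputable section

namespace BestRankOne

variable {E : Type*} [NormedAddCommGroup E] [InnerProductSpace ℝ E] {d : ℕ}

/-- The Hilbert-Schmidt inner product on `⨂ᵈ E`: the bilinear form determined by
`⟨x₁ ⊗ ⋯ ⊗ x_d, y₁ ⊗ ⋯ ⊗ y_d⟩ = ∏ i, ⟨x i, y i⟩`. -/
def hsInner : (⨂[ℝ]^d E) →ₗ[ℝ] (⨂[ℝ]^d E) →ₗ[ℝ] ℝ :=
  PiTensorProduct.lift
    ((TensorPower.multilinearMapToDual ℝ E d).compLinearMap (fun _ => innerₗ E))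

theorem hsInner_tprod (x y : Fin d → E) :
    hsInner (PiTensorProduct.tprod ℝ x) (PiTensorProduct.tprod ℝ y)
      = ∏ i, inner ℝ (x i) (y i) := by
  simp [hsInner]

/-- The Hilbert-Schmidt norm of a tensor. -/
def hsNorm (z : ⨂[ℝ]^d E) : ℝ := Real.sqrt (hsInner z z)

/-- The multilinear form `L_z` of a tensor `z`, see `tensorForm_sum`. -/
def tensorForm (z : ⨂[ℝ]^d E) : MultilinearMap ℝ (fun _ : Fin d => E) ℝ :=
  (hsInner z).compMultilinearMap (PiTensorProduct.tprod ℝ)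

theorem tensorForm_sum {r : ℕ} (v : Fin r → Fin d → E) (y : Fin d → E) :
    tensorForm (∑ j, PiTensorProduct.tprod ℝ (v j)) y = ∑ j, ∏ i, inner ℝ (y i) (v j i) := by
  simp [tensorForm, hsInner_tprod, real_inner_comm]

/-- In an orthonormal basis the Hilbert-Schmidt inner product is the sum of the products of the
coordinates. -/
theorem hsInner_eq_sum {κ : Type*} [Fintype κ] (e : OrthonormalBasis κ ℝ E) (z w : ⨂[ℝ]^d E) :
    hsInner z w
      = ∑ k : Fin d → κ, tensorForm z (fun i => e (k i)) * tensorForm w (fun i => e (k i)) := by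
  induction z using PiTensorProduct.induction_on with
  | smul_tprod r x =>
    induction w using PiTensorProduct.induction_on with
    | smul_tprod s y =>
      classical
      simp only [tensorForm, LinearMap.compMultilinearMap_apply, map_smul, LinearMap.smul_apply,
        hsInner_tprod, smul_eq_mul]
      have h : ∀ i, inner ℝ (x i) (y i) = ∑ k, inner ℝ (x i) (e k) * inner ℝ (y i) (e k) := by
        intro i
        rw [← e.sum_inner_mul_inner (x i) (y i)]
        exact Finset.sum_congr rfl fun k _ => by rw [real_inner_comm (y i)]
      simp_rw [h, Finset.prod_univ_sum, Fintype.piFinset_univ, Finset.mul_sum,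
        Finset.prod_mul_distrib]
      exact Finset.sum_congr rfl fun k _ => by ring
    | add a b ha hb =>
      simp only [tensorForm, map_add, LinearMap.compMultilinearMap_apply, LinearMap.add_apply,
        mul_add, Finset.sum_add_distrib] at ha hb ⊢
      rw [ha, hb]
  | add a b ha hb =>
    simp only [tensorForm, map_add, LinearMap.compMultilinearMap_apply, LinearMap.add_apply,
      add_mul, Finset.sum_add_distrib] at ha hb ⊢
    rw [ha, hb]

theorem hsInner_self_nonneg [FiniteDimensional ℝ E] (z : ⨂[ℝ]^d E) : 0 ≤ hsInner z z := by
  rw [hsInner_eq_sum (stdOrthonormalBasis ℝ E)]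
  exact Finset.sum_nonneg fun k _ => mul_self_nonneg _

/-- A tensor is symmetric if it is fixed by every permutation of the `d` factors. -/
def IsSymmetricTensor (z : ⨂[ℝ]^d E) : Prop :=
  ∀ σ : Equiv.Perm (Fin d), PiTensorProduct.reindex ℝ (fun _ => E) σ z = z

/-- The tensor rank: the least `r` such that `z` is a sum of `r` elementary tensors (with value
`⊤` if there is no such `r`, which can only happen for `d = 0`). -/
def tensorRank (z : ⨂[ℝ]^d E) : ℕ∞ :=
  ⨅ (r : ℕ) (_ : ∃ v : Fin r → Fin d → E, z = ∑ j, PiTensorProduct.tprod ℝ (v j)), (r : ℕ∞)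

/-- `x` is a best rank-`r` approximation of `z` for the Hilbert-Schmidt norm: it has rank at most
`r` and is at least as close to `z` as every other tensor of rank at most `r`. -/
def IsBestRankApprox (r : ℕ) (z x : ⨂[ℝ]^d E) : Prop :=
  tensorRank x ≤ r ∧ ∀ y : ⨂[ℝ]^d E, tensorRank y ≤ r → hsNorm (z - x) ≤ hsNorm (z - y)

/-- A `d`-linear form is symmetric if it is invariant under permutations of its arguments. -/
def IsSymmetricForm (L : MultilinearMap ℝ (fun _ : Fin d => E) ℝ) : Prop :=
  ∀ (σ : Equiv.Perm (Fin d)) (y : Fin d → E), L (fun i => y (σ i)) = L y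

/-- The uniform (spectral) norm of a `d`-linear form. -/
def formNorm (L : MultilinearMap ℝ (fun _ : Fin d => E) ℝ) : ℝ :=
  sSup {t : ℝ | ∃ y : Fin d → E, (∀ i, ‖y i‖ = 1) ∧ t = |L y|}

/-- The supremum in `formNorm` is over a bounded set. -/
theorem formNorm_bddAbove [FiniteDimensional ℝ E]
    (L : MultilinearMap ℝ (fun _ : Fin d => E) ℝ) :
    BddAbove {t : ℝ | ∃ y : Fin d → E, (∀ i, ‖y i‖ = 1) ∧ t = |L y|} := by
  classical
  let e := stdOrthonormalBasis ℝ E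
  refine ⟨∑ k : Fin d → Fin (Module.finrank ℝ E), |L fun i => e (k i)|, ?_⟩
  rintro t ⟨y, hy, rfl⟩
  have h : y = fun i => ∑ j, inner ℝ (e j) (y i) • e j := by
    funext i
    exact (e.sum_repr' (y i)).symm
  rw [h, L.map_sum]
  refine (Finset.abs_sum_le_sum_abs _ _).trans (Finset.sum_le_sum fun k _ => ?_)
  rw [L.map_smul_univ, smul_eq_mul, abs_mul, Finset.abs_prod]
  refine mul_le_of_le_one_left (abs_nonneg _)
    (Finset.prod_le_one (fun i _ => abs_nonneg _) fun i _ => ?_)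
  have h1 := abs_real_inner_le_norm (e (k i)) (y i)
  rwa [hy i, e.orthonormal.1 (k i), one_mul] at h1

/-- The vectors `x i` as elements of their span. -/
def vecInSpan (x : Fin d → E) (i : Fin d) : Submodule.span ℝ (Set.range x) :=
  ⟨x i, Submodule.subset_span ⟨i, rfl⟩⟩

/-- The restriction of a `d`-linear form to a subspace. -/
def restrictForm (L : MultilinearMap ℝ (fun _ : Fin d => E) ℝ) (H : Submodule ℝ E) :
    MultilinearMap ℝ (fun _ : Fin d => H) ℝ :=
  L.compLinearMap (fun _ => H.subtype)

end BestRankOne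

end

noncomputable section

namespace BestRankOne

open Function

variable {E : Type*} [NormedAddCommGroup E] [InnerProductSpace ℝ E] {d : ℕ}

/-! ### Norm-attaining linear, bilinear and trilinear forms -/

theorem linearForm_eq_inner_of_norm_attained [FiniteDimensional ℝ E] (φ : E →ₗ[ℝ] ℝ) {c : ℝ}
    {v : E} (hφ : ∀ a, |φ a| ≤ |c| * ‖a‖) (hv : ‖v‖ = 1) (hc : φ v = c) (a : E) :
    φ a = c * inner ℝ v a := by
  obtain ⟨p, hp⟩ : ∃ p : E, ∀ a, φ a = inner ℝ p a :=
    ⟨(InnerProductSpace.toDual ℝ E).symm (LinearMap.toContinuousLinearMap φ), fun a => by simp⟩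
  have hpp : ‖p‖ ≤ |c| := by
    have h := hφ p
    rw [hp, real_inner_self_eq_norm_sq, abs_of_nonneg (by positivity)] at h
    by_contra! hlt
    nlinarith [abs_nonneg c]
  have hsq : ‖p‖ ^ 2 ≤ c ^ 2 := by
    rw [← sq_abs c]
    exact pow_le_pow_left₀ (norm_nonneg p) hpp 2
  have hzero : p - c • v = 0 := by
    rw [← norm_eq_zero, ← sq_nonpos_iff, norm_sub_sq_real, real_inner_smul_right, ← hp, hc,
      norm_smul, hv, mul_one, Real.norm_eq_abs, sq_abs]
    linarith
  rw [hp, sub_eq_zero.1 hzero, real_inner_smul_left]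

theorem bilinForm_add_self_of_norm_attained [FiniteDimensional ℝ E] (B : E →ₗ[ℝ] E →ₗ[ℝ] ℝ)
    {c : ℝ} {u v : E} (hB : ∀ a b, |B a b| ≤ |c| * ‖a‖ * ‖b‖) (hsymm : ∀ a b, B a b = B b a)
    (hu : ‖u‖ = 1) (hv : ‖v‖ = 1) (hc : B u v = c) :
    B (u + v) (u + v) = c * ‖u + v‖ ^ 2 := by
  have h1 := linearForm_eq_inner_of_norm_attained (B u) (c := c) (v := v)
    (fun a => by simpa [hu] using hB u a) hv hc
  have h2 := linearForm_eq_inner_of_norm_attained (B v) (c := c) (v := u)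
    (fun a => by simpa [hv] using hB v a) hu (by rw [hsymm, hc])
  rw [map_add B, LinearMap.add_apply, h1, h2, ← real_inner_self_eq_norm_sq, inner_add_left u v]
  ring

section Trilinear

variable [FiniteDimensional ℝ E] (f : E →ₗ[ℝ] E →ₗ[ℝ] E →ₗ[ℝ] ℝ) {c : ℝ} {u v w : E}

theorem trilinForm_add_self_of_norm_attained
    (hf : ∀ a b e, |f a b e| ≤ |c| * ‖a‖ * ‖b‖ * ‖e‖)
    (h12 : ∀ a b e, f a b e = f b a e) (h23 : ∀ a b e, f a b e = f a e b)
    (hu : ‖u‖ = 1) (hv : ‖v‖ = 1) (hw : ‖w‖ = 1) (hc : f u v w = c) (a : E) :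
    f (u + v) (u + v) a = c * ‖u + v‖ ^ 2 * inner ℝ w a := by
  have hmax := bilinForm_add_self_of_norm_attained (f w) (c := c) (u := u) (v := v)
    (fun a b => by simpa [hw] using hf w a b) (h23 w) hu hv
    (by rw [h12, h23, hc])
  rw [h12, h23, h12, h23, h12] at hmax
  refine linearForm_eq_inner_of_norm_attained (f (u + v) (u + v)) (c := c * ‖u + v‖ ^ 2)
    (fun a => ?_) hw ?_ a
  · refine (hf _ _ a).trans (le_of_eq ?_)
    rw [abs_mul, abs_of_nonneg (sq_nonneg ‖u + v‖)]
    ring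
  · rw [← hmax, h23, h12, h23]

theorem trilinForm_diag_of_norm_attained
    (hf : ∀ a b e, |f a b e| ≤ |c| * ‖a‖ * ‖b‖ * ‖e‖)
    (h12 : ∀ a b e, f a b e = f b a e) (h23 : ∀ a b e, f a b e = f a e b)
    (hu : ‖u‖ = 1) (hv : ‖v‖ = 1) (hw : ‖w‖ = 1) (hc : f u v w = c) (a : E) :
    f u u a + f v v a = 2 * c * inner ℝ u v * inner ℝ w a := by
  have h1 := trilinForm_add_self_of_norm_attained f hf h12 h23 hu hv hw hc a
  have h2 := linearForm_eq_inner_of_norm_attained (f u v) (c := c) (v := w)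
    (fun a => by simpa [hu, hv] using hf u v a) hw hc a
  rw [norm_add_sq_real, hu, hv] at h1
  simp only [map_add, LinearMap.add_apply] at h1
  rw [h12 v u, h2] at h1
  linear_combination h1

/-- If a symmetric trilinear form attains its norm at `(e, e, w)`, this computes it at
`(w, w, a)`. -/
theorem trilinForm_self_self_of_norm_attained
    (hf : ∀ a b e, |f a b e| ≤ |c| * ‖a‖ * ‖b‖ * ‖e‖)
    (h12 : ∀ a b e, f a b e = f b a e) (h23 : ∀ a b e, f a b e = f a e b)
    (hu : ‖u‖ = 1) (hw : ‖w‖ = 1) (hc : f u u w = c) (a : E) :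
    f w w a = 2 * c * inner ℝ u w * inner ℝ u a - c * inner ℝ w a := by
  have h1 := trilinForm_diag_of_norm_attained f hf h12 h23 hu hw hu (by rw [h23, hc]) a
  have h2 := linearForm_eq_inner_of_norm_attained (f u u) (c := c) (v := w)
    (fun a => by simpa [hu] using hf u u a) hw hc a
  linarith

theorem mem_span_pair_of_trilinForm_norm_attained (hc0 : c ≠ 0)
    (hf : ∀ a b e, |f a b e| ≤ |c| * ‖a‖ * ‖b‖ * ‖e‖)
    (h12 : ∀ a b e, f a b e = f b a e) (h23 : ∀ a b e, f a b e = f a e b)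
    (hu : ‖u‖ = 1) (hv : ‖v‖ = 1) (hw : ‖w‖ = 1) (hc : f u v w = c)
    (huv : u ≠ v) (huv' : u ≠ -v) : w ∈ Submodule.span ℝ {u, v} := by
  have key : ∀ (c' : ℝ) (v' : E), |c'| = |c| → ‖v'‖ = 1 → f u v' w = c' → u + v' ≠ 0 → ∀ a,
      f w w a = 2 * c' * inner ℝ (‖u + v'‖⁻¹ • (u + v')) w * inner ℝ (‖u + v'‖⁻¹ • (u + v')) a
        - c' * inner ℝ w a := by
    intro c' v' hcc hv' hc' hne a
    have hf' : ∀ a b e, |f a b e| ≤ |c'| * ‖a‖ * ‖b‖ * ‖e‖ := by rwa [hcc]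
    have hpos : ‖u + v'‖ ≠ 0 := norm_ne_zero_iff.2 hne
    refine trilinForm_self_self_of_norm_attained f hf' h12 h23 ?_ hw ?_ a
    · rw [norm_smul, norm_inv, norm_norm, inv_mul_cancel₀ hpos]
    · simp only [map_smul, LinearMap.smul_apply, smul_eq_mul]
      rw [trilinForm_add_self_of_norm_attained f hf' h12 h23 hu hv' hw hc' w,
        real_inner_self_eq_norm_sq, hw]
      field_simp
  have hp := key c v rfl hv hc fun h => huv' (eq_neg_of_add_eq_zero_left h)
  have hm := key (-c) (-v) (abs_neg c) (by rwa [norm_neg]) (by simp [hc])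
    fun h => huv (by simpa using eq_neg_of_add_eq_zero_left h)
  set p := ‖u + v‖⁻¹ • (u + v) with hpdef
  set q := ‖u + -v‖⁻¹ • (u + -v) with hqdef
  have hw' : w = inner ℝ p w • p + inner ℝ q w • q := by
    refine ext_inner_right ℝ fun a => mul_left_cancel₀ hc0 ?_
    rw [inner_add_left, real_inner_smul_left _ _ (inner ℝ p w),
      real_inner_smul_left _ _ (inner ℝ q w)]
    linarith [hp a, hm a]
  have hmu : u ∈ Submodule.span ℝ {u, v} := Submodule.subset_span (by simp)
  have hmv : v ∈ Submodule.span ℝ {u, v} := Submodule.subset_span (by simp)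
  rw [hw']
  exact add_mem
    (Submodule.smul_mem _ _ (Submodule.smul_mem _ _ (add_mem hmu hmv)))
    (Submodule.smul_mem _ _ (Submodule.smul_mem _ _ (add_mem hmu (neg_mem hmv))))

end Trilinear

/-! ### Norm-attaining symmetric multilinear forms -/

/-- `L` attains its norm `|c|` at the tuple `x` of unit vectors, with value `c`. -/
structure AttainsNormAt (L : MultilinearMap ℝ (fun _ : Fin d => E) ℝ) (x : Fin d → E) (c : ℝ) :
    Prop where
  norm_eq : ∀ i, ‖x i‖ = 1
  apply_eq : L x = c
  le : ∀ y, |L y| ≤ |c| * ∏ i, ‖y i‖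

theorem abs_le_mul_prod_norm (L : MultilinearMap ℝ (fun _ : Fin d => E) ℝ) {C : ℝ}
    (h : ∀ y : Fin d → E, (∀ i, ‖y i‖ = 1) → |L y| ≤ C) (y : Fin d → E) :
    |L y| ≤ C * ∏ i, ‖y i‖ := by
  by_cases h0 : ∃ i, y i = 0
  · obtain ⟨i, hi⟩ := h0
    rw [L.map_coord_zero i hi, Finset.prod_eq_zero (Finset.mem_univ i) (by rw [hi, norm_zero])]
    simp
  · push Not at h0
    have hy : y = fun i => ‖y i‖ • (‖y i‖⁻¹ • y i) := by
      funext i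
      rw [smul_smul, mul_inv_cancel₀ (norm_ne_zero_iff.2 (h0 i)), one_smul]
    have h1 := h (fun i => ‖y i‖⁻¹ • y i) fun i => by
      rw [norm_smul, norm_inv, norm_norm, inv_mul_cancel₀ (norm_ne_zero_iff.2 (h0 i))]
    have hP : 0 ≤ ∏ i, ‖y i‖ := Finset.prod_nonneg fun i _ => norm_nonneg _
    conv_lhs => rw [hy, L.map_smul_univ, smul_eq_mul, abs_mul, abs_of_nonneg hP]
    rw [mul_comm]
    exact mul_le_mul_of_nonneg_right h1 hP

/-- The bilinear form obtained from `L` by fixing all arguments but two. -/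
def bilinSlice (L : MultilinearMap ℝ (fun _ : Fin d => E) ℝ) (x : Fin d → E) {i j : Fin d}
    (hij : i ≠ j) : E →ₗ[ℝ] E →ₗ[ℝ] ℝ :=
  LinearMap.mk₂ ℝ (fun a b => L (update (update x i a) j b))
    (fun a a' b => by
      simp only [update_comm hij]
      exact L.map_update_add _ _ _ _)
    (fun r a b => by
      simp only [update_comm hij]
      exact L.map_update_smul _ _ _ _)
    (fun a b b' => L.map_update_add _ _ _ _)
    (fun r a b => L.map_update_smul _ _ _ _)

/-- The trilinear form obtained from `L` by fixing all arguments but three. -/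
def trilinSlice (L : MultilinearMap ℝ (fun _ : Fin d => E) ℝ) (x : Fin d → E) {i j k : Fin d}
    (hij : i ≠ j) (hik : i ≠ k) (hjk : j ≠ k) : E →ₗ[ℝ] E →ₗ[ℝ] E →ₗ[ℝ] ℝ where
  toFun a := bilinSlice L (update x i a) hjk
  map_add' a a' := by
    ext b e
    simp only [bilinSlice, LinearMap.mk₂_apply, LinearMap.add_apply, update_comm hij,
      update_comm hik]
    exact L.map_update_add _ _ _ _
  map_smul' r a := by
    ext b e
    simp only [bilinSlice, LinearMap.mk₂_apply, LinearMap.smul_apply, update_comm hij,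
      update_comm hik, RingHom.id_apply]
    exact L.map_update_smul _ _ _ _

theorem IsSymmetricForm.update_swap {L : MultilinearMap ℝ (fun _ : Fin d => E) ℝ}
    (hL : IsSymmetricForm L) (x : Fin d → E) {i j : Fin d} (hij : i ≠ j) (a b : E) :
    L (update (update x i a) j b) = L (update (update x i b) j a) := by
  rw [← hL (Equiv.swap i j)]
  congr 1
  funext k
  by_cases hki : k = i
  · subst hki
    simp [update_of_ne hij]
  · by_cases hkj : k = j
    · subst hkj
      simp [update_of_ne hij]
    · simp [Equiv.swap_apply_of_ne_of_ne hki hkj, hki, hkj]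

theorem prod_norm_update {F : Type*} [NormedAddCommGroup F] (x : Fin d → F) (i : Fin d)
    (hi : ‖x i‖ = 1) (a : F) :
    ∏ k, ‖update x i a k‖ = ‖a‖ * ∏ k, ‖x k‖ := by
  rw [Finset.prod_eq_mul_prod_sdiff_singleton_of_mem (Finset.mem_univ i),
    Finset.prod_eq_mul_prod_sdiff_singleton_of_mem (Finset.mem_univ i) (fun k => ‖x k‖), hi,
    one_mul, update_self]
  congr 1
  refine Finset.prod_congr rfl fun k hk => ?_
  rw [update_of_ne (by simpa using hk)]

theorem norm_update_eq_one {F : Type*} [NormedAddCommGroup F] {x : Fin d → F} (hx : ∀ i, ‖x i‖ = 1)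
    (i : Fin d) {a : F} (ha : ‖a‖ = 1) (k : Fin d) : ‖update x i a k‖ = 1 := by
  by_cases h : k = i
  · subst h; simpa using ha
  · rw [update_of_ne h]; exact hx k

namespace AttainsNormAt

variable {L : MultilinearMap ℝ (fun _ : Fin d => E) ℝ} {x : Fin d → E} {c : ℝ}

theorem abs_update_le (h : AttainsNormAt L x c) (i : Fin d) (a : E) :
    |L (update x i a)| ≤ |c| * ‖a‖ := by
  have h1 := h.le (update x i a)
  rwa [prod_norm_update x i (h.norm_eq i), Finset.prod_eq_one fun k _ => h.norm_eq k,
    mul_one] at h1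

theorem abs_update_update_le (h : AttainsNormAt L x c) {i j : Fin d} (hij : i ≠ j) (a b : E) :
    |L (update (update x i a) j b)| ≤ |c| * ‖a‖ * ‖b‖ := by
  have h1 := h.le (update (update x i a) j b)
  rw [prod_norm_update _ j (by rw [update_of_ne hij.symm]; exact h.norm_eq j),
    prod_norm_update x i (h.norm_eq i), Finset.prod_eq_one fun k _ => h.norm_eq k] at h1
  linarith

theorem abs_update_update_update_le (h : AttainsNormAt L x c) {i j k : Fin d} (hij : i ≠ j)
    (hik : i ≠ k) (hjk : j ≠ k) (a b e : E) :
    |L (update (update (update x i a) j b) k e)| ≤ |c| * ‖a‖ * ‖b‖ * ‖e‖ := by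
  have h1 := h.le (update (update (update x i a) j b) k e)
  rw [prod_norm_update _ k
      (by rw [update_of_ne hjk.symm, update_of_ne hik.symm]; exact h.norm_eq k),
    prod_norm_update _ j (by rw [update_of_ne hij.symm]; exact h.norm_eq j),
    prod_norm_update x i (h.norm_eq i), Finset.prod_eq_one fun k _ => h.norm_eq k] at h1
  linarith

theorem apply_update [FiniteDimensional ℝ E] (h : AttainsNormAt L x c) (i : Fin d) (a : E) :
    L (update x i a) = c * inner ℝ (x i) a :=
  linearForm_eq_inner_of_norm_attained (L.toLinearMap x i) (h.abs_update_le i) (h.norm_eq i)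
    (by simpa using h.apply_eq) a

/-- Two arguments of a maximizer may be replaced by their normalized sum. -/
theorem merge [FiniteDimensional ℝ E] (hL : IsSymmetricForm L) (h : AttainsNormAt L x c)
    {i j : Fin d} (hij : i ≠ j) {r : ℝ} (hr : ‖r • (x i + x j)‖ = 1) :
    AttainsNormAt L (update (update x i (r • (x i + x j))) j (r • (x i + x j))) c where
  norm_eq := norm_update_eq_one (norm_update_eq_one h.norm_eq i hr) j hr
  le := h.le
  apply_eq := by
    have h1 := bilinForm_add_self_of_norm_attained (bilinSlice L x hij) (c := c)
      (h.abs_update_update_le hij) (hL.update_swap x hij) (h.norm_eq i) (h.norm_eq j)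
      (by simpa [bilinSlice] using h.apply_eq)
    change bilinSlice L x hij (r • (x i + x j)) (r • (x i + x j)) = c
    simp only [map_smul, LinearMap.smul_apply, smul_eq_mul]
    rw [h1]
    have h2 : r ^ 2 * ‖x i + x j‖ ^ 2 = 1 := by
      rw [← sq_abs r, ← mul_pow, ← Real.norm_eq_abs, ← norm_smul, hr, one_pow]
    linear_combination c * h2

theorem perm (hL : IsSymmetricForm L) (h : AttainsNormAt L x c) (σ : Equiv.Perm (Fin d)) :
    AttainsNormAt L (fun i => x (σ i)) c :=
  ⟨fun i => h.norm_eq (σ i), (hL σ x).trans h.apply_eq, h.le⟩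

theorem mem_span_pair [FiniteDimensional ℝ E] (hL : IsSymmetricForm L) (h : AttainsNormAt L x c)
    (hc : c ≠ 0) {i j : Fin d} (hne : x i ≠ x j) (hne' : x i ≠ -x j) (k : Fin d) :
    x k ∈ Submodule.span ℝ {x i, x j} := by
  by_cases hik : i = k
  · subst hik; exact Submodule.subset_span (by simp)
  by_cases hjk : j = k
  · subst hjk; exact Submodule.subset_span (by simp)
  have hij : i ≠ j := fun e => hne (by rw [e])
  refine mem_span_pair_of_trilinForm_norm_attained (trilinSlice L x hij hik hjk) hc
    (h.abs_update_update_update_le hij hik hjk) (fun a b e => ?_)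
    (fun a b e => hL.update_swap (update x i a) hjk b e)
    (h.norm_eq i) (h.norm_eq j) (h.norm_eq k) ?_ hne hne'
  · change L (update (update (update x i a) j b) k e) = L (update (update (update x i b) j a) k e)
    have hcomm : ∀ a b : E, update (update (update x i a) j b) k e
        = update (update (update x k e) i a) j b := fun a b => by
      rw [update_comm hjk, update_comm hik]
    rw [hcomm, hcomm, hL.update_swap _ hij]
  · change L (update (update (update x i (x i)) j (x j)) k (x k)) = c
    simpa using h.apply_eq

theorem exists_mem_span_pair [FiniteDimensional ℝ E] (hL : IsSymmetricForm L)
    (h : AttainsNormAt L x c) (hc : c ≠ 0) : ∃ p q : E, ∀ k, x k ∈ Submodule.span ℝ {p, q} := by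
  by_cases hex : ∃ i j, x i ≠ x j ∧ x i ≠ -x j
  · obtain ⟨i, j, hne, hne'⟩ := hex
    exact ⟨x i, x j, h.mem_span_pair hL hc hne hne'⟩
  · push Not at hex
    rcases isEmpty_or_nonempty (Fin d) with he | ⟨⟨i⟩⟩
    · exact ⟨0, 0, fun k => he.elim k⟩
    · have hi : x i ∈ Submodule.span ℝ {x i, x i} := Submodule.subset_span (by simp)
      refine ⟨x i, x i, fun k => ?_⟩
      by_cases hk : x k = x i
      · rwa [hk]
      · rw [hex k i hk]
        exact neg_mem hi

end AttainsNormAt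

theorem finrank_span_le_two {p q : E} {x : Fin d → E} (h : ∀ k, x k ∈ Submodule.span ℝ {p, q}) :
    Module.finrank ℝ (Submodule.span ℝ (Set.range x)) ≤ 2 := by
  classical
  have hle : Submodule.span ℝ (Set.range x) ≤ Submodule.span ℝ (({p, q} : Finset E) : Set E) := by
    rw [Submodule.span_le]
    rintro _ ⟨k, rfl⟩
    simpa using h k
  exact (Submodule.finrank_mono hle).trans
    ((finrank_span_finset_le_card _).trans Finset.card_le_two)

/-! ### Uniqueness in dimension two -/

theorem mem_span_pair_of_finrank_eq_two (hE : Module.finrank ℝ E = 2) {u v : E} (hu : ‖u‖ = 1)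
    (hv : ‖v‖ = 1) (huv : u ≠ v) (huv' : u ≠ -v) (a : E) : ∃ r s : ℝ, r • u + s • v = a := by
  have hu0 : u ≠ 0 := fun h => by simp [h] at hu
  have hli : LinearIndependent ℝ ![u, v] := by
    rw [LinearIndependent.pair_iff' hu0]
    rintro r rfl
    rw [norm_smul, hu, mul_one, Real.norm_eq_abs] at hv
    rcases eq_or_eq_neg_of_abs_eq hv with rfl | rfl
    · exact huv (by simp)
    · exact huv' (by simp)
  have : FiniteDimensional ℝ E := Module.finite_of_finrank_pos (by omega)
  have htop := hli.span_eq_top_of_card_eq_finrank' (by simp [hE])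
  rw [Matrix.range_cons, Matrix.range_cons, Matrix.range_empty, Set.union_empty,
    Set.singleton_union] at htop
  exact Submodule.mem_span_pair.1 (htop ▸ Submodule.mem_top)

theorem eq_of_eq_update_update (hE : Module.finrank ℝ E = 2)
    (L M : MultilinearMap ℝ (fun _ : Fin d => E) ℝ) {u v : E} (hu : ‖u‖ = 1)
    (hv : ‖v‖ = 1) (huv : u ≠ v) (huv' : u ≠ -v) (y : Fin d → E) (k : Fin d)
    (h1 : L (update y k u) = M (update y k u)) (h2 : L (update y k v) = M (update y k v)) :
    L y = M y := by
  obtain ⟨r, s, hrs⟩ := mem_span_pair_of_finrank_eq_two hE hu hv huv huv' (y k)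
  rw [← update_eq_self k y, ← hrs, L.map_update_add, M.map_update_add]
  simp only [MultilinearMap.map_update_smul, h1, h2]

/-- Two symmetric forms on a plane which attain the same norm at the same tuple `x` agree on all
tuples which differ from `x` only at the places in a set `S` such that the `x i` with `i ∈ S` are
not all parallel. -/
theorem eq_on_of_attainsNormAt (hE : Module.finrank ℝ E = 2)
    {L M : MultilinearMap ℝ (fun _ : Fin d => E) ℝ} (hL : IsSymmetricForm L)
    (hM : IsSymmetricForm M) {c : ℝ} (m : ℕ) :
    ∀ (S : Finset (Fin d)) (x : Fin d → E), S.card = m → AttainsNormAt L x c →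
      AttainsNormAt M x c → ∀ i ∈ S, ∀ j ∈ S, x i ≠ x j → x i ≠ -x j →
      ∀ y : Fin d → E, (∀ k, k ∉ S → y k = x k) → L y = M y := by
  have : FiniteDimensional ℝ E := Module.finite_of_finrank_pos (by omega)
  induction m with
  | zero =>
    intro S x hS _ _ i hi
    simp [Finset.card_eq_zero.1 hS] at hi
  | succ m ih =>
    intro S x hS hLx hMx i hi j hj hne hne' y hy
    have hij : i ≠ j := fun e => hne (by rw [e])
    by_cases hk : ∃ k ∈ S, k ≠ i ∧ k ≠ j
    · have hne2 : x j ≠ -x i := fun e => hne' (by rw [e, neg_neg])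
      obtain ⟨k, hkS, hki, hkj⟩ := hk
      have hcard : (S.erase k).card = m := by rw [Finset.card_erase_of_mem hkS, hS]; rfl
      have step : ∀ x' : Fin d → E, AttainsNormAt L x' c → AttainsNormAt M x' c →
          (∀ l, l ∉ S → x' l = x l) → x' i ≠ x' j → x' i ≠ -x' j →
          L (update y k (x' k)) = M (update y k (x' k)) := by
        intro x' h1 h2 hx' hn hn'
        refine ih (S.erase k) x' hcard h1 h2 i (by simp [hi, hki.symm]) j
          (by simp [hj, hkj.symm]) hn hn' _ fun l hl => ?_
        by_cases hlk : l = k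
        · subst hlk; simp
        · have hlS : l ∉ S := fun h => hl (Finset.mem_erase.2 ⟨hlk, h⟩)
          rw [update_of_ne hlk, hy l hlS, hx' l hlS]
      have hfirst := step x hLx hMx (fun _ _ => rfl) hne hne'
      -- a second direction in slot `k`, found by merging `k` with a slot not parallel to it
      have hmerge : ∀ p q : Fin d, p ∈ S → k ≠ p → q ≠ k → q ≠ p → x k = x q ∨ x k = -x q →
          x p ≠ x q → x p ≠ -x q → (p = i ∧ q = j ∨ p = j ∧ q = i) → L y = M y := by
        intro p q hpS hkp hqk hqp hpar hpq hpq' hcase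
        have hpk : x p ≠ x k := by rcases hpar with e | e <;> rwa [e]
        have hpk' : x p ≠ -x k := by rcases hpar with e | e <;> simpa [e]
        have hsum : x p + x k ≠ 0 := fun e => hpk' (eq_neg_of_add_eq_zero_left e)
        have hsum0 : ‖x p + x k‖ ≠ 0 := norm_ne_zero_iff.2 hsum
        set r := ‖x p + x k‖⁻¹ with hrdef
        have hr : ‖r • (x p + x k)‖ = 1 := by
          rw [norm_smul, norm_inv, norm_norm, inv_mul_cancel₀ hsum0]
        have hr0 : r ≠ 0 := inv_ne_zero hsum0
        have hli : ∀ s : ℝ, r • (x p + x k) ≠ s • x k := by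
          intro s hs
          have hs' : x p = (r⁻¹ * s - 1) • x k := by
            have h3 : x p + x k = (r⁻¹ * s) • x k := by
              rw [mul_smul, ← hs, inv_smul_smul₀ hr0]
            rw [sub_smul, one_smul, ← h3, add_sub_cancel_right]
          have h4 := congrArg norm hs'
          rw [norm_smul, hLx.norm_eq, hLx.norm_eq, mul_one, Real.norm_eq_abs] at h4
          rcases eq_or_eq_neg_of_abs_eq h4.symm with e | e <;> rw [e] at hs'
          · exact hpk (by simpa using hs')
          · exact hpk' (by simpa using hs')
        have hek : r • (x p + x k) ≠ x k := by simpa using hli 1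
        have hek' : r • (x p + x k) ≠ -x k := by simpa using hli (-1)
        have heq : r • (x p + x k) ≠ x q := by
          rcases hpar with e | e
          · rwa [← e]
          · rwa [← neg_eq_iff_eq_neg.2 e]
        have heq' : r • (x p + x k) ≠ -x q := by
          rcases hpar with e | e
          · rwa [← e]
          · rwa [← e]
        set x' := update (update x p (r • (x p + x k))) k (r • (x p + x k)) with hx'
        have hxk : x' k = r • (x p + x k) := by simp [hx']
        have hxp : x' p = r • (x p + x k) := by simp [hx', hkp.symm]
        have hxq : x' q = x q := by simp [hx', hqk, hqp]
        have hoff : ∀ l, l ∉ S → x' l = x l := by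
          intro l hl
          have h5 : l ≠ k := fun e => hl (e ▸ hkS)
          have h6 : l ≠ p := fun e => hl (e ▸ hpS)
          simp [hx', h5, h6]
        have hsecond := step x' (hLx.merge hL hkp.symm hr) (hMx.merge hM hkp.symm hr) hoff
          (by
            rcases hcase with ⟨rfl, rfl⟩ | ⟨rfl, rfl⟩
            · rwa [hxp, hxq]
            · rw [hxp, hxq]; exact heq.symm)
          (by
            rcases hcase with ⟨rfl, rfl⟩ | ⟨rfl, rfl⟩
            · rwa [hxp, hxq]
            · rw [hxp, hxq]; exact fun e => heq' (by rw [e, neg_neg]))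
        rw [hxk] at hsecond
        exact eq_of_eq_update_update hE L M hr (hLx.norm_eq k) hek hek' y k hsecond hfirst
      by_cases hpj : x k = x j ∨ x k = -x j
      · exact hmerge i j hi hki hkj.symm hij.symm hpj hne hne' (Or.inl ⟨rfl, rfl⟩)
      by_cases hpi : x k = x i ∨ x k = -x i
      · exact hmerge j i hj hkj hki.symm hij hpi hne.symm hne2 (Or.inr ⟨rfl, rfl⟩)
      push Not at hpi hpj
      have hsecond := step (fun l => x (Equiv.swap i k l)) (hLx.perm hL _) (hMx.perm hM _)
        (fun l hl => by
          rw [Equiv.swap_apply_of_ne_of_ne (fun e : l = i => hl (e ▸ hi))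
            (fun e : l = k => hl (e ▸ hkS))])
        (by simpa [Equiv.swap_apply_of_ne_of_ne hij.symm hkj.symm] using hpj.1)
        (by simpa [Equiv.swap_apply_of_ne_of_ne hij.symm hkj.symm] using hpj.2)
      simp only [Equiv.swap_apply_right] at hsecond
      exact eq_of_eq_update_update hE L M (hLx.norm_eq k) (hLx.norm_eq i) hpi.1 hpi.2 y k hfirst
        hsecond
    · push Not at hk
      have hyx : ∀ a : E, update y i a = update (update x i a) j (y j) := by
        intro a
        funext l
        by_cases hlj : l = j
        · subst hlj; simp [hij.symm]
        rw [update_of_ne hlj]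
        by_cases hli : l = i
        · subst hli; simp
        rw [update_of_ne hli, update_of_ne hli]
        exact hy l fun hl => hlj (hk l hl hli)
      refine eq_of_eq_update_update hE L M (hLx.norm_eq i) (hLx.norm_eq j) hne hne' y i ?_ ?_
      · rw [hyx, update_eq_self, hLx.apply_update, hMx.apply_update]
      · rw [hyx, hL.update_swap x hij, hM.update_swap x hij, update_comm hij, update_eq_self,
          hLx.apply_update, hMx.apply_update]

theorem eq_of_attainsNormAt (hE : Module.finrank ℝ E = 2)
    {L M : MultilinearMap ℝ (fun _ : Fin d => E) ℝ} (hL : IsSymmetricForm L)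
    (hM : IsSymmetricForm M) {c : ℝ} {x : Fin d → E} (hLx : AttainsNormAt L x c)
    (hMx : AttainsNormAt M x c) {i j : Fin d} (hne : x i ≠ x j) (hne' : x i ≠ -x j) : L = M := by
  ext y
  exact eq_on_of_attainsNormAt hE hL hM _ Finset.univ x rfl hLx hMx i (Finset.mem_univ i) j
    (Finset.mem_univ j) hne hne' y fun k hk => absurd (Finset.mem_univ k) hk

theorem exists_not_parallel {x : Fin d → E}
    (h : Module.finrank ℝ (Submodule.span ℝ (Set.range x)) = 2) :
    ∃ i j, x i ≠ x j ∧ x i ≠ -x j := by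
  by_contra! hex
  have hle : ∃ p : E, Submodule.span ℝ (Set.range x) ≤ Submodule.span ℝ {p} := by
    rcases isEmpty_or_nonempty (Fin d) with he | ⟨⟨i⟩⟩
    · exact ⟨0, by simp [Set.range_eq_empty]⟩
    · refine ⟨x i, Submodule.span_le.2 ?_⟩
      rintro _ ⟨k, rfl⟩
      by_cases hk : x k = x i
      · rw [hk]; exact Submodule.mem_span_singleton_self _
      · rw [hex k i hk]; exact neg_mem (Submodule.mem_span_singleton_self _)
  obtain ⟨p, hp⟩ := hle
  have h1 := (Submodule.finrank_mono hp).trans (finrank_span_le_card {p})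
  simp [h] at h1

/-! ### Best rank-one approximations -/

theorem eq_sum_tensorForm_smul {κ : Type*} [Fintype κ] (e : OrthonormalBasis κ ℝ E)
    (z : ⨂[ℝ]^d E) :
    z = ∑ k : Fin d → κ,
      tensorForm z (fun i => e (k i)) • PiTensorProduct.tprod ℝ (fun i => e (k i)) := by
  induction z using PiTensorProduct.induction_on with
  | smul_tprod r x =>
    classical
    have hx : x = fun i => ∑ k, inner ℝ (e k) (x i) • e k :=
      funext fun i => (e.sum_repr' (x i)).symm
    conv_lhs => rw [hx, MultilinearMap.map_sum, Finset.smul_sum]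
    refine Finset.sum_congr rfl fun k _ => ?_
    rw [MultilinearMap.map_smul_univ, smul_smul]
    congr 1
    simp [tensorForm, hsInner_tprod, real_inner_comm]
  | add a b ha hb =>
    conv_lhs => rw [ha, hb]
    simp [tensorForm, add_smul, Finset.sum_add_distrib]

theorem hsInner_comm (z w : ⨂[ℝ]^d E) : hsInner z w = hsInner w z := by
  induction z using PiTensorProduct.induction_on with
  | smul_tprod r x =>
    induction w using PiTensorProduct.induction_on with
    | smul_tprod s y =>
      simp only [map_smul, LinearMap.smul_apply, hsInner_tprod, smul_eq_mul, real_inner_comm]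
      ring
    | add a b ha hb => rw [map_add, ha, hb, map_add, LinearMap.add_apply]
  | add a b ha hb => rw [map_add, LinearMap.add_apply, ha, hb, map_add]

theorem hsInner_reindex (σ : Equiv.Perm (Fin d)) (z w : ⨂[ℝ]^d E) :
    hsInner (PiTensorProduct.reindex ℝ (fun _ => E) σ z)
      (PiTensorProduct.reindex ℝ (fun _ => E) σ w) = hsInner z w := by
  induction z using PiTensorProduct.induction_on with
  | smul_tprod r x =>
    induction w using PiTensorProduct.induction_on with
    | smul_tprod s y =>
      simp only [map_smul, LinearMap.smul_apply, PiTensorProduct.reindex_tprod, hsInner_tprod]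
      rw [Equiv.prod_comp σ.symm (fun i => inner ℝ (x i) (y i))]
    | add a b ha hb => simp only [map_add, ha, hb]
  | add a b ha hb => simp only [map_add, LinearMap.add_apply, ha, hb]

theorem IsSymmetricTensor.isSymmetricForm {z : ⨂[ℝ]^d E} (hz : IsSymmetricTensor z) :
    IsSymmetricForm (tensorForm z) := by
  intro σ y
  have h := hsInner_reindex σ.symm z (PiTensorProduct.tprod ℝ y)
  rw [hz, PiTensorProduct.reindex_tprod] at h
  exact h

theorem tensorRank_smul_tprod_le_one [NeZero d] (t : ℝ) (y : Fin d → E) :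
    tensorRank (t • PiTensorProduct.tprod ℝ y) ≤ 1 := by
  refine iInf₂_le_of_le 1 ⟨fun _ => update y 0 (t • y 0), ?_⟩ (by simp)
  simp

theorem hsInner_sub_smul_tprod (z : ⨂[ℝ]^d E) (t : ℝ) {y : Fin d → E} (hy : ∀ i, ‖y i‖ = 1) :
    hsInner (z - t • PiTensorProduct.tprod ℝ y) (z - t • PiTensorProduct.tprod ℝ y)
      = hsInner z z - 2 * t * tensorForm z y + t ^ 2 := by
  have h1 : hsInner (PiTensorProduct.tprod ℝ y) (PiTensorProduct.tprod ℝ y) = 1 := by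
    rw [hsInner_tprod]
    exact Finset.prod_eq_one fun i _ => by rw [real_inner_self_eq_norm_sq, hy, one_pow]
  simp only [map_sub, LinearMap.sub_apply, map_smul, LinearMap.smul_apply, smul_eq_mul, h1,
    hsInner_comm (PiTensorProduct.tprod ℝ y) z, tensorForm, LinearMap.compMultilinearMap_apply]
  ring

theorem IsBestRankApprox.attainsNormAt [FiniteDimensional ℝ E] [NeZero d] {z : ⨂[ℝ]^d E} {c : ℝ}
    {x : Fin d → E} (hx : ∀ i, ‖x i‖ = 1)
    (h : IsBestRankApprox 1 z (c • PiTensorProduct.tprod ℝ x)) :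
    AttainsNormAt (tensorForm z) x c := by
  have key : ∀ (t : ℝ) (y : Fin d → E), (∀ i, ‖y i‖ = 1) →
      c ^ 2 - 2 * c * tensorForm z x ≤ t ^ 2 - 2 * t * tensorForm z y := by
    intro t y hy
    have h1 := h.2 _ (by exact_mod_cast tensorRank_smul_tprod_le_one t y)
    rw [hsNorm, hsNorm, Real.sqrt_le_sqrt_iff (hsInner_self_nonneg _),
      hsInner_sub_smul_tprod z c hx, hsInner_sub_smul_tprod z t hy] at h1
    linarith
  have hc : tensorForm z x = c := by
    have h1 := key (tensorForm z x) x hx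
    have h2 : (c - tensorForm z x) ^ 2 ≤ 0 := by linarith
    exact (sub_eq_zero.1 (sq_nonpos_iff _ |>.1 h2)).symm
  refine ⟨hx, hc, abs_le_mul_prod_norm _ fun y hy => sq_le_sq.1 ?_⟩
  have h1 := key (tensorForm z y) y hy
  rw [hc] at h1
  linarith

theorem eq_zero_of_attainsNormAt_zero [FiniteDimensional ℝ E] {z : ⨂[ℝ]^d E} {x : Fin d → E}
    (h : AttainsNormAt (tensorForm z) x 0) : z = 0 := by
  rw [eq_sum_tensorForm_smul (stdOrthonormalBasis ℝ E) z]
  refine Finset.sum_eq_zero fun k _ => ?_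
  have h1 := h.le fun i => stdOrthonormalBasis ℝ E (k i)
  rw [abs_zero, zero_mul] at h1
  rw [abs_nonpos_iff.1 h1, zero_smul]

theorem AttainsNormAt.formNorm_eq {L : MultilinearMap ℝ (fun _ : Fin d => E) ℝ} {x : Fin d → E}
    {c : ℝ} (h : AttainsNormAt L x c) : formNorm L = |c| := by
  refine IsGreatest.csSup_eq ⟨⟨x, h.norm_eq, by rw [h.apply_eq]⟩, ?_⟩
  rintro t ⟨y, hy, rfl⟩
  simpa [hy] using h.le y

theorem attainsNormAt_of_formNorm_eq [FiniteDimensional ℝ E]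
    {L : MultilinearMap ℝ (fun _ : Fin d => E) ℝ} {x : Fin d → E} {c : ℝ} (hx : ∀ i, ‖x i‖ = 1)
    (hn : formNorm L = |c|) (hc : L x = c) : AttainsNormAt L x c :=
  ⟨hx, hc, abs_le_mul_prod_norm L fun y hy =>
    hn ▸ le_csSup (formNorm_bddAbove L) ⟨y, hy, rfl⟩⟩

theorem AttainsNormAt.restrictForm {L : MultilinearMap ℝ (fun _ : Fin d => E) ℝ} {x : Fin d → E}
    {c : ℝ} (h : AttainsNormAt L x c) :
    AttainsNormAt (restrictForm L (Submodule.span ℝ (Set.range x))) (vecInSpan x) c :=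
  ⟨h.norm_eq, h.apply_eq, fun y => h.le fun i => (y i : E)⟩

end BestRankOne

end

theorem mainTheorem4 (n d : ℕ) (z : ⨂[ℝ]^d (EuclideanSpace ℝ (Fin n)))
    (hz : BestRankOne.IsSymmetricTensor z)
    (c : ℝ) (x : Fin d → EuclideanSpace ℝ (Fin n)) (hx : ∀ i, ‖x i‖ = 1)
    (hbest : BestRankOne.IsBestRankApprox 1 z (c • PiTensorProduct.tprod ℝ x)) :
    (z ≠ 0 → Module.finrank ℝ (Submodule.span ℝ (Set.range x)) ≤ 2) ∧
    (Module.finrank ℝ (Submodule.span ℝ (Set.range x)) = 2 →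
      ∀ T : MultilinearMap ℝ (fun _ : Fin d => Submodule.span ℝ (Set.range x)) ℝ,
        (BestRankOne.IsSymmetricForm T ∧ BestRankOne.formNorm T = |c| ∧
            T (BestRankOne.vecInSpan x) = c) ↔
          T = BestRankOne.restrictForm (BestRankOne.tensorForm z)
            (Submodule.span ℝ (Set.range x))) := by
  rcases Nat.eq_zero_or_pos d with rfl | hd
  · have h0 : Module.finrank ℝ (Submodule.span ℝ (Set.range x)) = 0 := by
      simp [Set.range_eq_empty]
    exact ⟨fun _ => by omega, fun h => by omega⟩
  have : NeZero d := ⟨hd.ne'⟩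
  have hmax := hbest.attainsNormAt hx
  have hsymm := hz.isSymmetricForm
  refine ⟨fun hz0 => ?_, fun h2 T => ?_⟩
  · have hc : c ≠ 0 := by
      rintro rfl
      exact hz0 (BestRankOne.eq_zero_of_attainsNormAt_zero hmax)
    obtain ⟨p, q, hpq⟩ := hmax.exists_mem_span_pair hsymm hc
    exact BestRankOne.finrank_span_le_two hpq
  · have hres := hmax.restrictForm
    have hsymm' : BestRankOne.IsSymmetricForm (BestRankOne.restrictForm
        (BestRankOne.tensorForm z) (Submodule.span ℝ (Set.range x))) :=
      fun σ y => hsymm σ fun i => (y i : EuclideanSpace ℝ (Fin n))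
    constructor
    · rintro ⟨hT, hn, hc⟩
      obtain ⟨i, j, hne, hne'⟩ := BestRankOne.exists_not_parallel h2
      exact BestRankOne.eq_of_attainsNormAt h2 hT hsymm'
        (BestRankOne.attainsNormAt_of_formNorm_eq hres.norm_eq hn hc) hres (i := i) (j := j)
        (fun e => hne (congrArg Subtype.val e)) (fun e => hne' (congrArg Subtype.val e))
    · rintro rfl
      exact ⟨hsymm', hres.formNorm_eq, hres.apply_eq⟩
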